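/- Let $G$ and $H$ be free groups of finite rank with fixed free bases $a_1,\dots,a_n$ of $G$ and $b_1,\dots,b_m$ of $H$ (so $\operatorname{rank} G=n$ and $\operatorname{rank} H=m$). For $p\in\mathbb N$ let $H_p$ be the finite set of elements of $H$ whose reduced word in the $b_j$ has length at most $p$. Identify a homomorphism $\phi:G\to H$ with the tuple $(\phi(a_1),\dots,\phi(a_n))\in H^n$, and define the (asymptotic) density of a set $S$ of homomorphisms $G\to H$, viewed as a subset of $H^n$, by $$D(S)=\lim_{p\to\infty}\frac{|S\cap (H_p)^n|}{|(H_p)^n|},$$ when the limit exists. Let $\mathrm{Epi}(G,H)$ and $\mathrm{Mono}(G,H)$ be the sets of all surjective and of all injective homomorphisms $G\to H$, respectively. Then the following densities exist and have the stated values. 1. If the rank of $H$ is $1$ and the rank of $G$ is $n>1$, then $$D(\mathrm{Epi}(G,H))=\frac1{\zeta(n)},\qquad D(\mathrm{Mono}(G,H))=0,$$ where $\zeta$ is the Riemann zeta function. (Note that $\zeta(n)\to1$ as $n\to\infty$.) 2. If the ranks of $G$ and $H$ are both $1$, or the rank of $H$ is greater than $1$, then $$D(\mathrm{Epi}(G,H))=0,\qquad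 D(\mathrm{Mono}(G,H))=1.$$ -/

import Mathlib

open Filter Topology

open Classical in
/-- The reduced word length `|w|` of an element `w` of a free group `H`, with respect to a
free basis `b` of `H`. -/
noncomputable def wordLength {κ H : Type*} [Group H] (b : FreeGroupBasis κ H) (w : H) : ℕ :=
  (b.repr w).toWord.length

/-- `H_p`: the set of all elements of reduced word length at most `p`. -/
def wordBall {κ H : Type*} [Group H] (b : FreeGroupBasis κ H) (p : ℕ) : Set H :=
  {w | wordLength b w ≤ p}

/-- `(H_p)^l`: the tuples (indexed by `ι`) all of whose entries have length at most `p`. -/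
def tupleBall {κ H : Type*} [Group H] (b : FreeGroupBasis κ H) (ι : Type*) (p : ℕ) :
    Set (ι → H) :=
  {t | ∀ i, t i ∈ wordBall b p}

/-- Balls in a free group of finite rank are finite, so that counting their elements
makes sense. -/
theorem wordBall_finite {κ H : Type*} [Group H] [Finite κ] (b : FreeGroupBasis κ H) (p : ℕ) :
    (wordBall b p).Finite := by
  classical
  refine Set.Finite.of_finite_image (f := fun w => (b.repr w).toWord)
    ((List.finite_length_le (κ × Bool) p).subset ?_) ?_
  · rintro _ ⟨w, hw, rfl⟩
    change (b.repr w).toWord.length ≤ p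
    have h : wordLength b w ≤ p := hw
    unfold wordLength at h
    convert h
  · exact (FreeGroup.toWord_injective.comp b.repr.injective).injOn

/-- Finitely indexed powers of balls are finite. -/
theorem tupleBall_finite {κ H ι : Type*} [Group H] [Finite κ] [Finite ι]
    (b : FreeGroupBasis κ H) (p : ℕ) : (tupleBall b ι p).Finite := by
  have h := Set.Finite.pi (fun _ : ι => wordBall_finite b p)
  exact h.subset fun t ht i _ => ht i

/-- A set `S` of tuples of elements of `H` has asymptotic density `d`:
`|S ∩ (H_p)^l| / |(H_p)^l|` tends to `d` as `p → ∞`. -/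
def HasTupleDensity {κ H ι : Type*} [Group H] (b : FreeGroupBasis κ H)
    (S : Set (ι → H)) (d : ℝ) : Prop :=
  Tendsto (fun p : ℕ => ((S ∩ tupleBall b ι p).ncard : ℝ) / ((tupleBall b ι p).ncard : ℝ))
    atTop (𝓝 d)

/-- A set `S` of homomorphisms `G → H` has asymptotic density `d`, where a homomorphism `φ` is
viewed as the tuple of the images `φ (a i)` of the elements of the free basis `a` of `G`. -/
def HasHomDensity {ι κ G H : Type*} [Group G] [Group H] (a : FreeGroupBasis ι G)
    (b : FreeGroupBasis κ H) (S : Set (G →* H)) (d : ℝ) : Prop :=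
  HasTupleDensity b ((fun (φ : G →* H) (i : ι) => φ (a i)) '' S) d

/-- The set of surjective homomorphisms `G → H`. -/
def Epis (G H : Type*) [Group G] [Group H] : Set (G →* H) :=
  {φ | Function.Surjective φ}

/-- The set of injective homomorphisms `G → H`. -/
def Monos (G H : Type*) [Group G] [Group H] : Set (G →* H) :=
  {φ | Function.Injective φ}

/-! If `H` has rank at least 2, almost every tuple satisfies a small cancellation condition: entries
of length at least 2L, whose values and inverses have pairwise distinct prefixes of length L. In a
reduced word evaluated at such a tuple, each factor loses fewer than L letters to the product of
those after it, so nontrivial words have values of length at least L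
(`SmallCancellation.le_norm_lift`). For L ≥ 2 the homomorphism is then injective and misses the
basis elements. Each way of violating the condition confines one entry, given the others, to at most
as many values as the ball of radius p - L has elements. Balls grow at least by a factor 3 per unit
of radius, so the exceptions have proportion O(3^(-L)); take L = ⌊p/3⌋.

If `H` has rank 1, tuples of elements of length at most p are the integer points of [-p, p]^n, and
surjectivity means that the coordinates are coprime. Möbius inversion and dominated convergence give
the density ∑ μ(d)/d^n = 1/ζ(n). For n > 1 injectivity fails because `G` is not commutative; for n =
1 all exceptions lie in {-1, 0, 1}. -/

namespace FreeGroup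

/-! ### Small cancellation in free groups. -/

variable {α ι : Type*}

/-- Cancellation in a product of two reduced words: the cancelled part is a common prefix `c` of
the second factor and of the inverse of the first. -/
theorem IsReduced.exists_cancellation : ∀ {y x : List (α × Bool)}, IsReduced x → IsReduced y →
    ∃ c x' y', x = x' ++ invRev c ∧ y = c ++ y' ∧ IsReduced (x' ++ y')
  | [], x, hx, _ => ⟨[], x, [], by simp, by simp, by simpa using hx⟩
  | a :: y, x, hx, hy => by
    -- If `x` ends with the inverse of `a`, that pair cancels and the recursion continues; otherwise
    -- nothing cancels.
    by_cases h : ∃ x₂, x = x₂ ++ invRev [a]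
    · obtain ⟨x₂, rfl⟩ := h
      obtain ⟨c, x', y', h₁, h₂, h₃⟩ := IsReduced.exists_cancellation (y := y)
        (hx.infix (L₁ := x₂) ⟨[], invRev [a], by simp⟩) (hy.infix ⟨[a], [], by simp⟩)
      exact ⟨a :: c, x', y', by rw [h₁, invRev_cons (L := c), List.append_assoc], by rw [h₂]; rfl, h₃⟩
    · refine ⟨[], x, a :: y, by simp, by simp, ?_⟩
      refine List.IsChain.append hx hy ?_
      intro l hl m hm hlm
      simp only [List.head?_cons, Option.mem_def, Option.some.injEq] at hm
      subst hm
      by_contra hne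
      obtain ⟨x₂, rfl⟩ := List.mem_getLast?_eq_getLast hl |> fun ⟨h₁, h₂⟩ =>
        (⟨x.dropLast, by rw [h₂]; exact (List.dropLast_append_getLast h₁).symm⟩ :
          ∃ x₂, x = x₂ ++ [l])
      refine h ⟨x₂, ?_⟩
      obtain ⟨l₁, l₂⟩ := l
      obtain ⟨a₁, a₂⟩ := a
      simp only at hlm hne
      subst hlm
      cases l₂ <;> cases a₂ <;> simp_all [invRev]

/-- The letter `s = (i, ε)` evaluated at a tuple `x`: this is `x i` or its inverse. -/
def evalLetter {H : Type*} [Group H] (x : ι → H) (s : ι × Bool) : H :=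
  cond s.2 (x s.1) (x s.1)⁻¹

theorem evalLetter_not {H : Type*} [Group H] (x : ι → H) (s : ι × Bool) :
    evalLetter x (s.1, !s.2) = (evalLetter x s)⁻¹ := by
  rcases s with ⟨i, _ | _⟩ <;> simp [evalLetter]

theorem lift_mk_eq_prod_evalLetter {H : Type*} [Group H] (x : ι → H) (w : List (ι × Bool)) :
    lift x (mk w) = (w.map (evalLetter x)).prod := by
  rw [lift_mk]; rfl

variable [DecidableEq α]

theorem norm_evalLetter (x : ι → FreeGroup α) (s : ι × Bool) :
    (evalLetter x s).norm = (x s.1).norm := by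
  rcases s with ⟨i, _ | _⟩ <;> simp [evalLetter]

/-- The entries of a tuple of elements of a free group have length at least `2 L`, and the
prefixes of length `L` of these entries and of their inverses are pairwise distinct. -/
structure SmallCancellation (L : ℕ) (x : ι → FreeGroup α) : Prop where
  two_mul_le_norm : ∀ i, 2 * L ≤ (x i).norm
  take_ne : ∀ s t : ι × Bool, s ≠ t →
    (evalLetter x s).toWord.take L ≠ (evalLetter x t).toWord.take L

namespace SmallCancellation

variable {L : ℕ} {x : ι → FreeGroup α}

/-- By induction, the product of the later factors starts with the first L letters of the value of
`t`, since the length minus L is at least L. If L letters of the value of `s` cancelled, the inverse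
of `s` and `t` would have values with the same prefix of length L, although these letters differ
because the word is reduced. -/
theorem take_prefix_toWord_prod (hx : SmallCancellation L x) : ∀ (w : List (ι × Bool))
    (s : ι × Bool), IsReduced (s :: w) →
    (evalLetter x s).toWord.take ((evalLetter x s).norm - L) <+:
      (((s :: w).map (evalLetter x)).prod).toWord
  | [], s, _ => by simpa using List.take_prefix _ _
  | t :: w, s, h => by
    rw [isReduced_cons_cons] at h
    have ih := hx.take_prefix_toWord_prod w t h.2
    have hst : (s.1, !s.2) ≠ t := by
      rintro rfl
      simpa using h.1 rfl
    have hlen : ∀ s, 2 * L ≤ (evalLetter x s).toWord.length := fun s => by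
      have := hx.two_mul_le_norm s.1
      rwa [← norm_evalLetter x s] at this
    rw [List.map_cons, List.prod_cons, toWord_mul]
    generalize ((t :: w).map (evalLetter x)).prod = y at ih
    obtain ⟨c, x', y', h₁, h₂, h₃⟩ := IsReduced.exists_cancellation
      (isReduced_toWord (x := evalLetter x s)) (isReduced_toWord (x := y))
    have hc : c.length < L := by
      by_contra! hc
      refine hx.take_ne _ _ hst ?_
      have e₁ : (evalLetter x (s.1, !s.2)).toWord.take L = c.take L := by
        rw [evalLetter_not, toWord_inv, h₁, invRev_append, invRev_invRev,
          List.take_append_of_le_length hc]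
      have e₂ : y.toWord.take L = c.take L := by
        rw [h₂, List.take_append_of_le_length hc]
      obtain ⟨z, hz⟩ := ih
      have e₃ : y.toWord.take L = (evalLetter x t).toWord.take L := by
        have := hlen t
        rw [← hz, norm, List.take_append_of_le_length (by rw [List.length_take]; omega),
          List.take_take, min_eq_left (by omega)]
      rw [e₁, ← e₂, e₃]
    have hmul : reduce ((evalLetter x s).toWord ++ y.toWord) = x' ++ y' := by
      rw [← h₃.reduce_eq, h₁, h₂]
      refine reduce.sound ?_
      simp only [← mul_mk, ← inv_mk]
      group
    rw [hmul]
    have hxl := congrArg List.length h₁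
    rw [List.length_append, invRev_length] at hxl
    refine List.IsPrefix.trans (l₂ := x') ?_ (List.prefix_append _ _)
    rw [norm, h₁, List.take_append_of_le_length (by simp; omega)]
    exact List.take_prefix _ _

theorem le_norm_lift (hx : SmallCancellation L x) [DecidableEq ι] {w : FreeGroup ι}
    (hw : w ≠ 1) : L ≤ (lift x w).norm := by
  rw [← mk_toWord (x := w), lift_mk_eq_prod_evalLetter]
  have hr := isReduced_toWord (x := w)
  rw [ne_eq, ← toWord_eq_nil_iff] at hw
  obtain ⟨s, v, hsv⟩ := List.exists_cons_of_ne_nil hw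
  rw [hsv] at hr ⊢
  have h := (hx.take_prefix_toWord_prod v s hr).length_le
  have := hx.two_mul_le_norm s.1
  rw [← norm_evalLetter x s, norm] at this
  rw [List.length_take, norm] at h
  rw [norm]
  omega

theorem lift_injective (hx : SmallCancellation L x) (hL : 0 < L) :
    Function.Injective (lift x) := by
  classical
  rw [injective_iff_map_eq_one]
  intro w hw
  by_contra h
  have := hx.le_norm_lift h
  rw [hw, norm_one] at this
  omega

/-- A basis element has length 1, too short to be a nontrivial value. -/
theorem not_surjective_lift [Nonempty α] (hx : SmallCancellation L x) (hL : 1 < L) :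
    ¬ Function.Surjective (lift x) := by
  classical
  intro h
  obtain ⟨k⟩ := ‹Nonempty α›
  obtain ⟨w, hw⟩ := h (of k)
  have := hx.le_norm_lift (w := w) (by rintro rfl; exact of_ne_one k (by rw [← hw, (lift x).map_one]))
  rw [hw, norm_of] at this
  omega

end SmallCancellation

end FreeGroup

/-! ### Counting tuples with constraints. -/

section Counting

open Finset

/-- A union bound. -/
theorem Finset.card_filter_exists_mul_le {E T : Type*} [Fintype E] (s : Finset T)
    (P : E → T → Prop) (c N : ℕ) [∀ e, DecidablePred (P e)] [DecidablePred fun t => ∃ e, P e t]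
    (h : ∀ e, #{t ∈ s | P e t} * c ≤ N) :
    #{t ∈ s | ∃ e, P e t} * c ≤ Fintype.card E * N := by
  classical
  have hsub : {t ∈ s | ∃ e, P e t} ⊆ univ.biUnion fun e => {t ∈ s | P e t} := by
    intro t ht
    simpa using ht
  calc #{t ∈ s | ∃ e, P e t} * c ≤ (∑ e, #{t ∈ s | P e t}) * c :=
        Nat.mul_le_mul_right _ ((card_le_card hsub).trans card_biUnion_le)
    _ = ∑ e, #{t ∈ s | P e t} * c := sum_mul ..
    _ ≤ ∑ _e : E, N := sum_le_sum fun e _ => h e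
    _ = Fintype.card E * N := by simp

/-- If a property of tuples with entries in `B` restricts the entry of index `i`, given the other
entries, to at most `N` values, then the proportion of the tuples having it is at most `N / #B`. -/
theorem Fintype.card_filter_piFinset_mul_le {ι H : Type*} [Fintype ι] [DecidableEq ι]
    (B : Finset H) (i : ι) (P : (ι → H) → Prop) [DecidablePred P] (N : ℕ)
    (h : ∀ t, #{x ∈ B | P (Function.update t i x)} ≤ N) :
    #{t ∈ piFinset fun _ : ι => B | P t} * #B ≤ N * #(piFinset fun _ : ι => B) := by
  classical
  have hle : #((piFinset fun _ : ι => B).sigma fun t => {x ∈ B | P (Function.update t i x)}) ≤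
      N * #(piFinset fun _ : ι => B) := by
    rw [Finset.card_sigma, mul_comm]
    exact sum_le_card_nsmul _ _ _ fun t _ => h t
  refine le_trans ?_ hle
  rw [← card_product]
  -- Exchanging the entry `t i` with the extra element `x` is reversible.
  refine card_le_card_of_injOn (fun y => ⟨Function.update y.1 i y.2, y.1 i⟩) ?_ ?_
  · rintro ⟨t, x⟩ hy
    simp only [coe_product, Set.mem_prod, mem_coe, mem_filter, mem_piFinset] at hy
    simp only [mem_coe, mem_sigma, mem_piFinset, mem_filter, Function.update_idem,
      Function.update_eq_self]
    refine ⟨fun j => ?_, hy.1.1 i, hy.1.2⟩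
    rcases eq_or_ne j i with rfl | hj
    · simpa using hy.2
    · simpa [hj] using hy.1.1 j
  · rintro ⟨t, x⟩ - ⟨t', x'⟩ - he
    simp only [Sigma.mk.injEq, heq_eq_eq] at he
    have h₁ : x = x' := by simpa using congrFun he.1 i
    have h₂ : t = t' := by
      have := congrArg (fun f => Function.update f i (t i)) he.1
      simp only [Function.update_idem, Function.update_eq_self] at this
      exact this.trans (by rw [he.2, Function.update_eq_self])
    rw [h₁, h₂]

end Counting

/-! ### Growth of balls and words with prescribed prefixes. -/

namespace FreeGroup

open Finset

variable (α : Type*) [Fintype α] [DecidableEq α]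

theorem finite_norm_le (p : ℕ) : {w : FreeGroup α | w.norm ≤ p}.Finite :=
  Set.Finite.of_finite_image (f := toWord)
    ((List.finite_length_le (α × Bool) p).subset (by rintro _ ⟨w, hw, rfl⟩; exact hw))
    toWord_injective.injOn

/-- The ball of radius `p` in a free group of finite rank. -/
noncomputable def ball (p : ℕ) : Finset (FreeGroup α) := (finite_norm_le α p).toFinset

variable {α}

@[simp] theorem mem_ball {p : ℕ} {w : FreeGroup α} : w ∈ ball α p ↔ w.norm ≤ p := by
  simp [ball]

theorem card_ball_pos (p : ℕ) : 0 < #(ball α p) := card_pos.2 ⟨1, by simp⟩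

/-- A reduced word can be extended on the left by every letter except the inverse of its first one,
hence by at least 2 · 2 - 1 = 3 letters, and the extension determines both the word and the letter.
-/
theorem card_ball_mul_three_le (hα : 1 < Fintype.card α) (p : ℕ) :
    #(ball α p) * 3 ≤ #(ball α (p + 1)) := by
  classical
  have hfib : ∀ w : FreeGroup α, 3 ≤ #{l : α × Bool | IsReduced (l :: w.toWord)} := by
    intro w
    have hcard : 4 ≤ #(univ : Finset (α × Bool)) := by
      rw [card_univ, Fintype.card_prod, Fintype.card_bool]; omega
    have hr := isReduced_toWord (x := w)
    rcases hw : w.toWord with _ | ⟨m, v⟩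
    · simp only [IsReduced.singleton, filter_true]; omega
    · rw [hw] at hr
      have := pred_card_le_card_erase (s := univ) (a := (m.1, !m.2))
      refine le_trans (by omega) (card_le_card (s := univ.erase (m.1, !m.2)) ?_)
      rintro ⟨l₁, l₂⟩ hl
      obtain ⟨m₁, m₂⟩ := m
      simp only [mem_erase, ne_eq, Prod.mk.injEq, mem_univ, and_true, not_and] at hl
      simp only [mem_filter, mem_univ, isReduced_cons_cons, hr, and_true, true_and]
      intro h
      have := hl h
      cases l₂ <;> cases m₂ <;> simp_all
  have hle : #(ball α p) * 3 ≤
      #((ball α p).sigma fun w => {l : α × Bool | IsReduced (l :: w.toWord)}) := by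
    rw [card_sigma]
    exact card_nsmul_le_sum _ _ _ fun w _ => hfib w
  refine hle.trans (card_le_card_of_injOn (fun y => mk (y.2 :: y.1.toWord)) ?_ ?_)
  · rintro ⟨w, l⟩ hy
    simp only [coe_sigma, Set.mem_sigma_iff, mem_coe, mem_ball] at hy
    simp only [mem_coe, mem_ball]
    exact norm_mk_le.trans (by simpa [norm] using hy.1)
  · rintro ⟨w, l⟩ hy ⟨w', l'⟩ hy' he
    simp only [coe_sigma, Set.mem_sigma_iff, mem_coe, mem_filter, mem_univ, true_and] at hy hy'
    have := reduce.sound he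
    rw [hy.2.reduce_eq, hy'.2.reduce_eq, List.cons.injEq, toWord_inj] at this
    rw [this.1, this.2]

theorem card_ball_mul_pow_le (hα : 1 < Fintype.card α) (p L : ℕ) :
    #(ball α p) * 3 ^ L ≤ #(ball α (p + L)) := by
  induction L with
  | zero => simp
  | succ L ih =>
    calc #(ball α p) * 3 ^ (L + 1) = #(ball α p) * 3 ^ L * 3 := by ring
      _ ≤ #(ball α (p + L)) * 3 := Nat.mul_le_mul_right _ ih
      _ ≤ _ := card_ball_mul_three_le hα _

theorem card_filter_take_toWord_eq_le (p L : ℕ) (u : List (α × Bool)) :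
    #{w ∈ ball α p | w.toWord.take L = u} ≤ #(ball α (p - L)) := by
  refine card_le_card_of_injOn (fun w => mk (w.toWord.drop L)) ?_ ?_
  · intro w hw
    simp only [coe_filter, mem_ball, Set.mem_ofPred_eq, norm] at hw
    simp only [mem_coe, mem_ball]
    refine norm_mk_le.trans ?_
    rw [List.length_drop]
    omega
  · intro w hw w' hw' he
    simp only [coe_filter, Set.mem_ofPred_eq] at hw hw'
    have hr : ∀ w : FreeGroup α, IsReduced (w.toWord.drop L) := fun w =>
      isReduced_toWord.infix (List.drop_suffix _ _).isInfix
    have := reduce.sound he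
    rw [(hr w).reduce_eq, (hr w').reduce_eq] at this
    rw [← toWord_inj, ← List.take_append_drop L w.toWord, ← List.take_append_drop L w'.toWord,
      hw.2, hw'.2, this]

theorem card_filter_take_toWord_inv_eq_le (p L : ℕ) (u : List (α × Bool)) :
    #{w ∈ ball α p | w⁻¹.toWord.take L = u} ≤ #(ball α (p - L)) := by
  refine le_trans ?_ (card_filter_take_toWord_eq_le p L u)
  refine card_le_card_of_injOn (fun w => w⁻¹) ?_ inv_injective.injOn
  intro w hw
  simpa using hw

/-- The last L letters are the formal inverse of the first L. As the two blocks do not overlap, the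
word can be recovered after its last L letters are deleted. -/
theorem card_filter_take_toWord_eq_take_inv_le (p L : ℕ) :
    #{w ∈ ball α p | 2 * L ≤ w.norm ∧ w.toWord.take L = w⁻¹.toWord.take L} ≤
      #(ball α (p - L)) := by
  refine card_le_card_of_injOn (fun w => mk (w.toWord.take (w.norm - L))) ?_ ?_
  · intro w hw
    simp only [coe_filter, mem_ball, Set.mem_ofPred_eq] at hw
    simp only [mem_coe, mem_ball]
    refine norm_mk_le.trans ?_
    rw [List.length_take]
    omega
  · intro w hw w' hw' he
    simp only [coe_filter, Set.mem_ofPred_eq] at hw hw'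
    have hr : ∀ w : FreeGroup α, IsReduced (w.toWord.take (w.norm - L)) := fun w =>
      isReduced_toWord.infix (List.take_prefix _ _).isInfix
    have hdrop : ∀ w : FreeGroup α, 2 * L ≤ w.norm → w.toWord.take L = w⁻¹.toWord.take L →
        w.toWord = w.toWord.take (w.norm - L) ++
          invRev ((w.toWord.take (w.norm - L)).take L) := by
      intro w h₁ h₂
      have hd : w.toWord.drop (w.norm - L) = invRev (w⁻¹.toWord.take L) := by
        conv_lhs => rw [← inv_inv w, toWord_inv]
        rw [invRev, invRev, norm_inv_eq, List.map_take, List.reverse_take]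
        simp [norm]
      rw [List.take_take, min_eq_left (by omega), h₂, ← hd, List.take_append_drop]
    have := reduce.sound he
    rw [(hr w).reduce_eq, (hr w').reduce_eq] at this
    rw [← toWord_inj, hdrop w hw.2.1 hw.2.2, hdrop w' hw'.2.1 hw'.2.2, this]

end FreeGroup

/-! ### Small cancellation is generic. -/

namespace FreeGroup

open Finset

variable {α ι : Type*} [Fintype α] [DecidableEq α] [Fintype ι] [DecidableEq ι]

/-- Tuples of elements of length at most `p` satisfy small cancellation with parameter `L`, with
exceptions whose proportion decays exponentially in `L`. -/
theorem card_filter_not_smallCancellation_mul_le (hα : 1 < Fintype.card α) {p L : ℕ}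
    (hL : 3 * L ≤ p) [DecidablePred fun x : ι → FreeGroup α => ¬ SmallCancellation L x] :
    #{x ∈ Fintype.piFinset fun _ : ι => ball α p | ¬ SmallCancellation L x} * 3 ^ L ≤
      Fintype.card (ι ⊕ (ι × Bool) × (ι × Bool)) *
        #(Fintype.piFinset fun _ : ι => ball α p) := by
  classical
  -- The possible failures: a short entry, or two letters with equal prefixes. Length is required in
  -- the second case because a letter and its inverse are compared through
  -- `card_filter_take_toWord_eq_take_inv_le`.
  let P : ι ⊕ (ι × Bool) × (ι × Bool) → (ι → FreeGroup α) → Prop := Sum.elim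
    (fun i x => (x i).norm < 2 * L)
    (fun q x => q.1 ≠ q.2 ∧ 2 * L ≤ (x q.1.1).norm ∧
      (evalLetter x q.1).toWord.take L = (evalLetter x q.2).toWord.take L)
  have hsub : {x ∈ Fintype.piFinset fun _ : ι => ball α p | ¬ SmallCancellation L x} ⊆
      {x ∈ Fintype.piFinset fun _ : ι => ball α p | ∃ e, P e x} := by
    intro x hx
    rw [mem_filter] at hx ⊢
    refine ⟨hx.1, ?_⟩
    by_contra! hP
    refine hx.2 ⟨fun i => ?_, fun s t hst he => ?_⟩
    · simpa [P] using hP (Sum.inl i)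
    · exact hP (Sum.inr (s, t)) ⟨hst, by simpa [P] using hP (Sum.inl s.1), he⟩
  refine (Nat.mul_le_mul_right _ (card_le_card hsub)).trans
    (card_filter_exists_mul_le _ P _ _ fun e => ?_)
  have hfib : ∃ i, ∀ x : ι → FreeGroup α,
      #{y ∈ ball α p | P e (Function.update x i y)} ≤ #(ball α (p - L)) := by
    rcases e with i | ⟨⟨i, ε⟩, ⟨j, δ⟩⟩
    · refine ⟨i, fun x => card_le_card fun y hy => ?_⟩
      simp only [P, Sum.elim_inl, mem_filter, Function.update_self] at hy
      -- Here 2L ≤ p - L, which is where `3 * L ≤ p` enters.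
      rw [mem_ball]
      omega
    · refine ⟨i, fun x => ?_⟩
      rcases eq_or_ne i j with rfl | hij
      · refine le_trans (card_le_card fun y hy => ?_)
          (card_filter_take_toWord_eq_take_inv_le p L)
        simp only [P, Sum.elim_inr, mem_filter, Function.update_self, evalLetter] at hy ⊢
        refine ⟨hy.1, hy.2.2.1, ?_⟩
        have h₁ := hy.2.1
        have h₂ := hy.2.2.2
        cases ε <;> cases δ <;> simp_all
      · cases ε
        · refine le_trans (card_le_card fun y hy => ?_) (card_filter_take_toWord_inv_eq_le p L
            ((evalLetter x (j, δ)).toWord.take L))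
          simp only [P, Sum.elim_inr, evalLetter, Function.update_self,
            Function.update_of_ne hij.symm, mem_filter] at hy
          exact mem_filter.2 ⟨hy.1, hy.2.2.2⟩
        · refine le_trans (card_le_card fun y hy => ?_) (card_filter_take_toWord_eq_le p L
            ((evalLetter x (j, δ)).toWord.take L))
          simp only [P, Sum.elim_inr, evalLetter, Function.update_self,
            Function.update_of_ne hij.symm, mem_filter] at hy
          exact mem_filter.2 ⟨hy.1, hy.2.2.2⟩
  obtain ⟨i, hi⟩ := hfib
  have h₁ := Fintype.card_filter_piFinset_mul_le (ball α p) i (P e) _ hi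
  have h₂ := card_ball_mul_pow_le hα (p - L) L
  rw [Nat.sub_add_cancel (by omega)] at h₂
  refine Nat.le_of_mul_le_mul_right ?_ (card_ball_pos (α := α) p)
  calc _ = #{x ∈ Fintype.piFinset fun _ : ι => ball α p | P e x} * #(ball α p) * 3 ^ L := by ring
    _ ≤ #(ball α (p - L)) * #(Fintype.piFinset fun _ : ι => ball α p) * 3 ^ L :=
      Nat.mul_le_mul_right _ h₁
    _ = #(Fintype.piFinset fun _ : ι => ball α p) * (#(ball α (p - L)) * 3 ^ L) := by ring
    _ ≤ _ := Nat.mul_le_mul_left _ h₂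

end FreeGroup

/-! ### Transfer from abstract bases to `FreeGroup`. -/

section Basis

variable {κ H ι G : Type*} [Group H] {b : FreeGroupBasis κ H} [Group G] (a : FreeGroupBasis ι G)

/-- By the universal property, evaluation on the basis has inverse `a.lift`; the image thus becomes
a preimage. -/
theorem image_eval_basis_eq (S : Set (G →* H)) :
    (fun (φ : G →* H) (i : ι) => φ (a i)) '' S = {t | a.lift t ∈ S} := by
  ext t
  constructor
  · rintro ⟨φ, hφ, rfl⟩
    have : a.lift (fun i => φ (a i)) = φ := a.ext_hom _ _ fun i => by simp
    rwa [Set.mem_ofPred_eq, this]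
  · intro ht
    exact ⟨a.lift t, ht, by funext i; simp⟩

theorem repr_lift_apply (t : ι → H) (g : G) :
    b.repr (a.lift t g) = FreeGroup.lift (fun i => b.repr (t i)) (a.repr g) := by
  have : (b.repr.toMonoidHom.comp (a.lift t)) =
      (FreeGroup.lift fun i => b.repr (t i)).comp a.repr.toMonoidHom :=
    a.ext_hom _ _ fun i => by simp
  exact DFunLike.congr_fun this g

theorem lift_injective_iff (t : ι → H) : Function.Injective (a.lift t) ↔
    Function.Injective (FreeGroup.lift fun i => b.repr (t i)) := by
  have : (b.repr ∘ a.lift t) = (FreeGroup.lift fun i => b.repr (t i)) ∘ a.repr :=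
    funext fun g => repr_lift_apply a t g
  rw [← b.repr.injective.of_comp_iff, this]
  exact Function.Injective.of_comp_iff' _ a.repr.bijective

theorem lift_surjective_iff (t : ι → H) : Function.Surjective (a.lift t) ↔
    Function.Surjective (FreeGroup.lift fun i => b.repr (t i)) := by
  have : (b.repr ∘ a.lift t) = (FreeGroup.lift fun i => b.repr (t i)) ∘ a.repr :=
    funext fun g => repr_lift_apply a t g
  rw [← Function.Surjective.of_comp_iff' b.repr.bijective, this]
  exact a.repr.surjective.of_comp_iff _

end Basis

/-! ### Densities, and targets of rank at least two. -/

section Density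

open FreeGroup Finset

variable {κ H ι : Type*} [Group H] [Fintype κ] [Fintype ι] (b : FreeGroupBasis κ H)

theorem tupleBall_ncard_pos (p : ℕ) : 0 < (tupleBall b ι p).ncard := by
  rw [Set.ncard_pos (tupleBall_finite b p)]
  refine ⟨fun _ => 1, fun _ => ?_⟩
  simp [wordBall, wordLength]

variable {b}

theorem HasTupleDensity.compl {S : Set (ι → H)} {d : ℝ} (h : HasTupleDensity b S d) :
    HasTupleDensity b Sᶜ (1 - d) := by
  refine Tendsto.congr (fun p => ?_) (tendsto_const_nhds.sub h)
  have hpos : (0 : ℝ) < (tupleBall b ι p).ncard := by exact_mod_cast tupleBall_ncard_pos b p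
  have hadd := Set.ncard_inter_add_ncard_sdiff_eq_ncard (tupleBall b ι p) S (tupleBall_finite b p)
  rw [Set.inter_comm Sᶜ, ← Set.sdiff_eq, Set.inter_comm S, eq_div_iff hpos.ne', sub_mul, one_mul,
    div_mul_cancel₀ _ hpos.ne', ← hadd]
  push_cast
  ring

theorem HasTupleDensity.mono_zero {S T : Set (ι → H)} (h : HasTupleDensity b T 0) (hST : S ⊆ T) :
    HasTupleDensity b S 0 := by
  refine squeeze_zero (fun p => by positivity) (fun p => ?_) h
  gcongr
  · exact (tupleBall_finite b p).inter_of_right _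

theorem norm_repr {κ H : Type*} [Group H] [DecidableEq κ] (b : FreeGroupBasis κ H) (w : H) :
    (b.repr w).norm = wordLength b w := by
  rw [FreeGroup.norm, wordLength]
  congr!

/-- Counting in a free group with a fixed basis amounts to counting reduced words. -/
theorem ncard_inter_tupleBall [DecidableEq κ] [DecidableEq ι] (S : Set (ι → H)) (p : ℕ)
    [DecidablePred fun x : ι → FreeGroup κ => (fun i => b.repr.symm (x i)) ∈ S] :
    (S ∩ tupleBall b ι p).ncard =
      #{x ∈ Fintype.piFinset fun _ : ι => ball κ p | (fun i => b.repr.symm (x i)) ∈ S} := by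
  classical
  have hinj : Function.Injective fun (t : ι → H) i => b.repr (t i) :=
    fun t t' h => funext fun i => b.repr.injective (congrFun h i)
  have himage : (fun (t : ι → H) i => b.repr (t i)) '' (S ∩ tupleBall b ι p) =
      ({x ∈ Fintype.piFinset fun _ : ι => ball κ p | (fun i => b.repr.symm (x i)) ∈ S} :
        Finset (ι → FreeGroup κ)) := by
    ext x
    rw [mem_coe, mem_filter, Fintype.mem_piFinset]
    constructor
    · rintro ⟨t, ht, rfl⟩
      refine ⟨fun i => ?_, by simpa using ht.1⟩
      rw [mem_ball, norm_repr]
      exact ht.2 i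
    · intro hx
      refine ⟨fun i => b.repr.symm (x i), ⟨hx.2, fun i => ?_⟩, by simp⟩
      rw [wordBall, Set.mem_ofPred_eq, ← norm_repr, MulEquiv.apply_symm_apply]
      exact mem_ball.1 (hx.1 i)
  rw [← Set.ncard_image_of_injective _ hinj, himage, Set.ncard_coe_finset]

theorem tupleBall_ncard [DecidableEq κ] [DecidableEq ι] (p : ℕ) :
    (tupleBall b ι p).ncard = #(Fintype.piFinset fun _ : ι => ball κ p) := by
  classical
  simpa using ncard_inter_tupleBall (b := b) (Set.univ : Set (ι → H)) p

/-- Generic tuples in a free group of rank at least two satisfy small cancellation. -/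
theorem hasTupleDensity_not_smallCancellation [DecidableEq κ] (hκ : 1 < Fintype.card κ) :
    HasTupleDensity b
      {t : ι → H | ¬ ∃ L, 1 < L ∧ SmallCancellation L fun i => b.repr (t i)} 0 := by
  classical
  have hlim : Tendsto (fun p : ℕ => (Fintype.card (ι ⊕ (ι × Bool) × (ι × Bool)) : ℝ) *
      ((3 : ℝ)⁻¹) ^ (p / 3)) atTop (𝓝 0) := by
    rw [← mul_zero (Fintype.card (ι ⊕ (ι × Bool) × (ι × Bool)) : ℝ)]
    exact ((tendsto_pow_atTop_nhds_zero_of_lt_one (by norm_num) (by norm_num)).comp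
      (Nat.tendsto_div_const_atTop (by norm_num))).const_mul _
  refine tendsto_of_tendsto_of_tendsto_of_le_of_le' tendsto_const_nhds hlim
    (Eventually.of_forall fun p => by positivity) ?_
  -- From 6 on, L = `p / 3` exceeds 1, as non-surjectivity needs.
  filter_upwards [eventually_ge_atTop 6] with p hp
  have hpos : (0 : ℝ) < (tupleBall b ι p).ncard := by exact_mod_cast tupleBall_ncard_pos b p
  rw [div_le_iff₀ hpos, ncard_inter_tupleBall, inv_pow, ← div_eq_mul_inv, div_mul_eq_mul_div,
    le_div_iff₀ (by positivity), tupleBall_ncard]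
  norm_cast
  refine le_trans (Nat.mul_le_mul_right _ (card_le_card fun x hx => ?_))
    (card_filter_not_smallCancellation_mul_le hκ (p := p) (L := p / 3) (by omega))
  simp only [mem_filter, Set.mem_ofPred_eq, MulEquiv.apply_symm_apply] at hx ⊢
  exact ⟨hx.1, fun h => hx.2 ⟨p / 3, by omega, h⟩⟩

variable {G : Type*} [Group G] (a : FreeGroupBasis ι G)

theorem hasHomDensity_epis_monos_of_one_lt_card (hκ : 1 < Fintype.card κ) :
    HasHomDensity a b (Epis G H) 0 ∧ HasHomDensity a b (Monos G H) 1 := by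
  classical
  have h := hasTupleDensity_not_smallCancellation (b := b) (ι := ι) hκ
  have : Nonempty κ := Fintype.card_pos_iff.1 (by omega)
  unfold HasHomDensity
  rw [image_eval_basis_eq, image_eval_basis_eq]
  constructor
  · refine h.mono_zero fun t ht => ?_
    rintro ⟨L, hL, hsc⟩
    exact hsc.not_surjective_lift hL ((lift_surjective_iff a t).1 ht)
  · have h' : HasTupleDensity b {t | a.lift t ∈ Monos G H}ᶜ 0 := by
      refine h.mono_zero fun t ht => ?_
      rintro ⟨L, hL, hsc⟩
      exact ht ((lift_injective_iff a t).2 (hsc.lift_injective (by omega)))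
    simpa using h'.compl

end Density

/-! ### The density of primitive integer points. -/

section VisiblePoints

open Finset ArithmeticFunction
open scoped ArithmeticFunction.Moebius ArithmeticFunction.zeta

/-- This is μ * ζ = 1, summed over a range independent of `g` so that the sum can be interchanged
with one over points. -/
theorem ArithmeticFunction.sum_Icc_moebius_eq_ite {g p : ℕ} (hg : 0 < g) (hp : g ≤ p) :
    ∑ d ∈ Icc 1 p, (if d ∣ g then μ d else 0) = if g = 1 then 1 else 0 := by
  rw [← sum_filter]
  have h : {d ∈ Icc 1 p | d ∣ g} = g.divisors := by
    ext d
    simp only [mem_filter, mem_Icc, Nat.mem_divisors]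
    constructor
    · exact fun h => ⟨h.2, hg.ne'⟩
    · exact fun h => ⟨⟨Nat.pos_of_dvd_of_pos h.1 hg, (Nat.le_of_dvd hg h.1).trans hp⟩, h.1⟩
  rw [h, ← coe_mul_zeta_apply, moebius_mul_coe_zeta, one_apply]

theorem Int.card_filter_Icc_dvd (p d : ℕ) (hd : 0 < d) :
    #{x ∈ Icc (-(p : ℤ)) p | (d : ℤ) ∣ x} = 2 * (p / d) + 1 := by
  have hd' : (0 : ℤ) < d := by exact_mod_cast hd
  have h : {x ∈ Icc (-(p : ℤ)) p | (d : ℤ) ∣ x} =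
      (Icc (-((p / d : ℕ) : ℤ)) ((p / d : ℕ) : ℤ)).image ((d : ℤ) * ·) := by
    ext x
    simp only [mem_filter, mem_Icc, mem_image]
    constructor
    · rintro ⟨hx, m, rfl⟩
      refine ⟨m, ?_, rfl⟩
      push_cast
      rw [neg_le, Int.le_ediv_iff_mul_le hd', Int.le_ediv_iff_mul_le hd']
      constructor <;> nlinarith
    · rintro ⟨m, hm, rfl⟩
      push_cast at hm
      rw [neg_le, Int.le_ediv_iff_mul_le hd', Int.le_ediv_iff_mul_le hd'] at hm
      exact ⟨⟨by nlinarith, by nlinarith⟩, dvd_mul_right _ _⟩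
  rw [h, card_image_of_injective _ fun x y hxy => mul_left_cancel₀ hd'.ne' hxy, Int.card_Icc]
  omega

variable {ι : Type*} [Fintype ι]

/-- The greatest common divisor of the coordinates of an integer point. -/
def coordGcd (k : ι → ℤ) : ℕ := univ.gcd fun i => (k i).natAbs

theorem dvd_coordGcd_iff (d : ℕ) (k : ι → ℤ) : d ∣ coordGcd k ↔ ∀ i, (d : ℤ) ∣ k i := by
  simp [coordGcd, Finset.dvd_gcd_iff, Int.natCast_dvd]

theorem coordGcd_eq_zero_iff (k : ι → ℤ) : coordGcd k = 0 ↔ k = 0 := by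
  simp [coordGcd, Finset.gcd_eq_zero_iff, funext_iff]

variable (ι) [DecidableEq ι]

/-- The integer points of the cube `[-p, p]^ι`. -/
noncomputable def intCube (p : ℕ) : Finset (ι → ℤ) := Fintype.piFinset fun _ => Icc (-(p : ℤ)) p

variable {ι}

theorem card_intCube (p : ℕ) : #(intCube ι p) = (2 * p + 1) ^ Fintype.card ι := by
  rw [intCube, Fintype.card_piFinset, prod_const, card_univ, Int.card_Icc]
  congr 1
  omega

theorem card_filter_intCube_dvd (p d : ℕ) (hd : 0 < d) :
    #{k ∈ intCube ι p | d ∣ coordGcd k} = (2 * (p / d) + 1) ^ Fintype.card ι := by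
  have h : {k ∈ intCube ι p | d ∣ coordGcd k} =
      Fintype.piFinset fun _ => {x ∈ Icc (-(p : ℤ)) p | (d : ℤ) ∣ x} := by
    ext k
    simp only [intCube, mem_filter, Fintype.mem_piFinset, dvd_coordGcd_iff, forall_and]
  rw [h, Fintype.card_piFinset, prod_const, card_univ, Int.card_filter_Icc_dvd p d hd]

theorem coordGcd_le {p : ℕ} {k : ι → ℤ} (hk : k ∈ intCube ι p) (hk0 : k ≠ 0) :
    coordGcd k ≤ p := by
  obtain ⟨i, hi⟩ := Function.ne_iff.1 hk0
  have h₁ := Nat.le_of_dvd (Int.natAbs_pos.2 hi)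
    (Finset.gcd_dvd (f := fun i => (k i).natAbs) (mem_univ i))
  have h₂ := mem_Icc.1 (Fintype.mem_piFinset.1 hk i)
  rw [coordGcd]
  omega

/-- The number of primitive integer points in a cube, by Möbius inversion. -/
theorem card_filter_intCube_coordGcd_eq_one (p : ℕ) :
    (#{k ∈ intCube ι p | coordGcd k = 1} : ℤ) =
      ∑ d ∈ Icc 1 p, μ d * ((2 * (p / d : ℕ) + 1) ^ Fintype.card ι - 1) := by
  have h0 : (0 : ι → ℤ) ∈ intCube ι p := by simp [intCube]
  have hg0 : coordGcd (0 : ι → ℤ) = 0 := (coordGcd_eq_zero_iff _).2 rfl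
  -- The origin has gcd 0, a multiple of every `d`. Removing it causes the `- 1` in each term.
  have h₁ : {k ∈ intCube ι p | coordGcd k = 1} =
      {k ∈ (intCube ι p).erase 0 | coordGcd k = 1} := by
    ext k
    simp only [mem_filter, mem_erase]
    refine ⟨fun h => ⟨⟨?_, h.1⟩, h.2⟩, fun h => ⟨h.1.2, h.2⟩⟩
    rintro rfl
    omega
  rw [h₁, card_filter]
  push_cast
  calc _ = ∑ k ∈ (intCube ι p).erase 0, ∑ d ∈ Icc 1 p, if d ∣ coordGcd k then μ d else 0 := by
        refine sum_congr rfl fun k hk => ?_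
        rw [mem_erase] at hk
        exact (sum_Icc_moebius_eq_ite (Nat.pos_of_ne_zero ((coordGcd_eq_zero_iff k).not.2 hk.1))
          (coordGcd_le hk.2 hk.1)).symm
    _ = _ := by
        rw [sum_comm]
        refine sum_congr rfl fun d hd => ?_
        rw [← sum_filter, sum_const, nsmul_eq_mul, mul_comm, filter_erase,
          card_erase_of_mem (by simp [h0, hg0]),
          card_filter_intCube_dvd p d (mem_Icc.1 hd).1,
          Nat.cast_sub (Nat.one_le_pow _ _ (by omega))]
        push_cast
        rfl

/-- The proportion of multiples of `d` in [-p, p]. For `d = 0` it also holds, with `p / 0 = 0` and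
limit `1 / 0 = 0`. -/
theorem tendsto_two_mul_div_add_one_div (d : ℕ) :
    Tendsto (fun p : ℕ => (2 * ((p / d : ℕ) : ℝ) + 1) / (2 * p + 1)) atTop (𝓝 (1 / d)) := by
  have h₁ : Tendsto (fun p : ℕ => ((p / d : ℕ) : ℝ) / p) atTop (𝓝 (1 / d)) := by
    have := (tendsto_nat_floor_mul_div_atTop (R := ℝ) (a := 1 / d) (by positivity)).comp
      tendsto_natCast_atTop_atTop
    refine this.congr fun p => ?_
    simp only [Function.comp_apply]
    rw [one_div_mul_eq_div, Nat.floor_div_eq_div]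
  have h₂ : Tendsto (fun p : ℕ => (1 : ℝ) / p) atTop (𝓝 0) := tendsto_one_div_atTop_nhds_zero_nat
  have h₃ := ((h₁.const_mul 2).add h₂).div (h₂.const_add 2) (by norm_num)
  have hlim : (2 * (1 / (d : ℝ)) + 0) / (2 + 0) = 1 / d := by ring
  rw [hlim] at h₃
  refine h₃.congr' ?_
  filter_upwards [eventually_gt_atTop 0] with p hp
  have : (0 : ℝ) < p := by exact_mod_cast hp
  simp only [Pi.div_apply]
  field_simp

/-- The Dirichlet series of μ is inverse to ζ on Re s > 1. The density is kept as a real series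
because `riemannZeta` is complex-valued. -/
theorem tsum_moebius_div_pow {n : ℕ} (hn : 1 < n) :
    ((∑' d : ℕ, (μ d : ℝ) * (1 / d) ^ n : ℝ) : ℂ) = 1 / riemannZeta n := by
  have hs : 1 < (n : ℂ).re := by simpa using hn
  have h := LSeries_zeta_mul_Lseries_moebius hs
  rw [LSeries_zeta_eq_riemannZeta hs] at h
  rw [eq_div_iff (riemannZeta_ne_zero_of_one_lt_re hs), mul_comm, ← h, Complex.ofReal_tsum,
    LSeries]
  congr 1
  refine tsum_congr fun d => ?_
  rw [LSeries.term_def₀ (by simp)]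
  push_cast
  rw [Complex.cpow_neg, Complex.cpow_natCast, one_div, inv_pow]

/-- The density of primitive points among the integer points of large cubes. -/
theorem tendsto_card_filter_coordGcd_eq_one_div (hι : 1 < Fintype.card ι) :
    Tendsto (fun p : ℕ => (#{k ∈ intCube ι p | coordGcd k = 1} : ℝ) / #(intCube ι p)) atTop
      (𝓝 (∑' d : ℕ, (μ d : ℝ) * (1 / d) ^ Fintype.card ι)) := by
  set n := Fintype.card ι with hn
  -- The two powers agree for `d > p` and for `d = 0`, where `p / d = 0`, so the finite Möbius sum
  -- is a series over all `d`.
  let f : ℕ → ℕ → ℝ := fun p d =>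
    μ d * (((2 * (p / d : ℕ) + 1) / (2 * p + 1)) ^ n - (1 / (2 * p + 1)) ^ n)
  have hf : ∀ p, (#{k ∈ intCube ι p | coordGcd k = 1} : ℝ) / #(intCube ι p) = ∑' d, f p d := by
    intro p
    have h := card_filter_intCube_coordGcd_eq_one (ι := ι) p
    have h' : (#{k ∈ intCube ι p | coordGcd k = 1} : ℝ) =
        ∑ d ∈ Icc 1 p, (μ d : ℝ) * ((2 * (p / d : ℕ) + 1) ^ n - 1) := by
      exact_mod_cast h
    rw [tsum_eq_sum (s := Icc 1 p), h', card_intCube, sum_div]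
    · refine sum_congr rfl fun d _ => ?_
      simp only [f]
      push_cast
      rw [div_pow, div_pow, one_pow, ← sub_div, mul_div_assoc]
    · intro d hd
      rw [mem_Icc, not_and_or] at hd
      have : p / d = 0 := by
        rcases hd with hd | hd
        · rw [show d = 0 by omega, Nat.div_zero]
        · exact Nat.div_eq_of_lt (by omega)
      simp [f, this]
  simp_rw [hf]
  -- For 0 < d ≤ p, (2⌊p/d⌋ + 1)d ≤ 2p + d ≤ 3p bounds the ratio by 2/d; the other terms vanish.
  refine tendsto_tsum_of_dominated_convergence (bound := fun d : ℕ => 2 ^ n * (1 / (d : ℝ) ^ n))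
    ((Real.summable_one_div_nat_pow.2 hι).mul_left _) (fun d => ?_) (Eventually.of_forall ?_)
  · have h₂ : Tendsto (fun p : ℕ => (1 : ℝ) / (2 * p + 1)) atTop (𝓝 0) := by
      refine squeeze_zero (fun p => by positivity) (fun p => ?_)
        tendsto_one_div_add_atTop_nhds_zero_nat
      gcongr
      linarith [p.cast_nonneg (α := ℝ)]
    have := (((tendsto_two_mul_div_add_one_div d).pow n).sub (h₂.pow n)).const_mul (μ d : ℝ)
    rwa [zero_pow (by omega), sub_zero] at this
  · intro p d
    rcases Nat.eq_zero_or_pos (p / d) with h0 | hpd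
    · simp only [f, h0, Nat.cast_zero, mul_zero, zero_add, sub_self, norm_zero]
      positivity
    have hd : 0 < d := Nat.pos_of_ne_zero (by rintro rfl; simp at hpd)
    have hd' : (0 : ℝ) < d := by exact_mod_cast hd
    have hle : (2 * ((p / d : ℕ) : ℝ) + 1) / (2 * p + 1) ≤ 2 * (1 / d) := by
      rw [mul_one_div, div_le_div_iff₀ (by positivity) hd']
      have h₁ : p / d * d ≤ p := Nat.div_mul_le_self p d
      have h₂ : d ≤ p := le_trans (Nat.le_mul_of_pos_left d hpd) h₁
      have : (2 * (p / d) + 1) * d ≤ 2 * (2 * p + 1) := by nlinarith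
      exact_mod_cast this
    have hμ : |(μ d : ℝ)| ≤ 1 := by exact_mod_cast abs_moebius_le_one
    have h1 : (1 / (2 * p + 1 : ℝ)) ^ n ≤ ((2 * ((p / d : ℕ) : ℝ) + 1) / (2 * p + 1)) ^ n := by
      gcongr
      linarith [(p / d).cast_nonneg (α := ℝ)]
    calc ‖f p d‖ = |(μ d : ℝ)| * |((2 * ((p / d : ℕ) : ℝ) + 1) / (2 * p + 1)) ^ n -
          (1 / (2 * p + 1 : ℝ)) ^ n| := by rw [Real.norm_eq_abs, abs_mul]
      _ ≤ 1 * ((2 * ((p / d : ℕ) : ℝ) + 1) / (2 * p + 1)) ^ n := by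
        gcongr
        rw [abs_of_nonneg (sub_nonneg.2 h1)]
        exact sub_le_self _ (by positivity)
      _ ≤ (2 * (1 / d)) ^ n := by
        rw [one_mul]
        gcongr
      _ = 2 ^ n * (1 / (d : ℝ) ^ n) := by rw [mul_pow, div_pow, one_pow]

/-- A Dirichlet series tends at infinity to its first coefficient. -/
theorem tendsto_riemannZeta_natCast_atTop :
    Tendsto (fun n : ℕ => riemannZeta (n : ℂ)) atTop (𝓝 1) := by
  have h := LSeries.tendsto_atTop (f := fun n => (ζ n : ℂ))
    (by rw [abscissaOfAbsConv_zeta]; exact EReal.coe_lt_top 1)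
  simp only [zeta_apply, one_ne_zero, if_false, Nat.cast_one] at h
  refine (h.comp tendsto_natCast_atTop_atTop).congr' ?_
  filter_upwards [eventually_gt_atTop 1] with n hn
  have hs : 1 < (n : ℂ).re := by simpa using hn
  rw [← LSeries_zeta_eq_riemannZeta hs]
  simp [zeta_apply]

end VisiblePoints

/-! ### Targets of rank one. -/

section RankOne

open FreeGroup Finset

namespace FreeGroup

theorem norm_of_zpow {α : Type*} [DecidableEq α] (x : α) (n : ℤ) :
    (of x ^ n).norm = n.natAbs := by
  obtain ⟨m, rfl | rfl⟩ := n.eq_nat_or_neg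
  · rw [zpow_natCast, norm_of_pow, Int.natAbs_natCast]
  · rw [zpow_neg, norm_inv_eq, zpow_natCast, norm_of_pow, Int.natAbs_neg, Int.natAbs_natCast]

theorem zpow_of_injective {α : Type*} (x : α) :
    Function.Injective fun n : ℤ => of x ^ n := by
  classical
  intro m n h
  have h' : (of x ^ (m - n)).norm = 0 := by
    rw [zpow_sub, show of x ^ m = of x ^ n from h, mul_inv_cancel, norm_one]
  rw [norm_of_zpow] at h'
  omega

theorem zpow_of_surjective {α : Type*} [Subsingleton α] (x : α) :
    Function.Surjective fun n : ℤ => of x ^ n := by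
  intro w
  have h : w ∈ Subgroup.zpowers (of x) := by
    induction w using FreeGroup.induction_on with
    | C1 => exact one_mem _
    | of y => rw [Subsingleton.elim y x]; exact Subgroup.mem_zpowers _
    | inv_of y _ => rw [Subsingleton.elim y x]; exact inv_mem (Subgroup.mem_zpowers _)
    | mul u v hu hv => exact mul_mem hu hv
  exact h

end FreeGroup

variable {κ H ι : Type*} [Group H] (b : FreeGroupBasis κ H)

theorem repr_zpow (x : κ) (n : ℤ) : b.repr (b x ^ n) = of x ^ n := by simp

theorem FreeGroupBasis.zpow_injective (x : κ) : Function.Injective fun n : ℤ => b x ^ n := by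
  intro m n h
  have := congrArg b.repr h
  simp only [repr_zpow] at this
  exact zpow_of_injective x this

theorem FreeGroupBasis.zpow_surjective [Subsingleton κ] (x : κ) :
    Function.Surjective fun n : ℤ => b x ^ n := by
  intro h
  obtain ⟨n, hn⟩ := zpow_of_surjective x (b.repr h)
  exact ⟨n, b.repr.injective (by rw [repr_zpow]; exact hn)⟩

theorem wordLength_zpow (x : κ) (n : ℤ) : wordLength b (b x ^ n) = n.natAbs := by
  classical
  rw [← norm_repr, repr_zpow, norm_of_zpow]

/-- Counting tuples in an infinite cyclic group amounts to counting integer points of cubes. -/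
theorem ncard_inter_tupleBall_of_subsingleton [Subsingleton κ] [Fintype ι] [DecidableEq ι]
    (x : κ) (S : Set (ι → H)) (p : ℕ) [DecidablePred fun k : ι → ℤ => (fun i => b x ^ k i) ∈ S] :
    (S ∩ tupleBall b ι p).ncard = #{k ∈ intCube ι p | (fun i => b x ^ k i) ∈ S} := by
  have hinj : Function.Injective fun (k : ι → ℤ) i => b x ^ k i :=
    fun k k' h => funext fun i => b.zpow_injective x (congrFun h i)
  have hmem : ∀ k : ι → ℤ, (fun i => b x ^ k i) ∈ tupleBall b ι p ↔ k ∈ intCube ι p := by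
    intro k
    rw [intCube, Fintype.mem_piFinset]
    refine forall_congr' fun i => ?_
    rw [wordBall, Set.mem_ofPred_eq, wordLength_zpow, mem_Icc]
    omega
  have himage : S ∩ tupleBall b ι p = (fun (k : ι → ℤ) i => b x ^ k i) ''
      ({k ∈ intCube ι p | (fun i => b x ^ k i) ∈ S} : Finset (ι → ℤ)) := by
    ext t
    constructor
    · intro ht
      choose k hk using fun i => b.zpow_surjective x (t i)
      obtain rfl : (fun i => b x ^ k i) = t := funext hk
      exact ⟨k, mem_coe.2 (mem_filter.2 ⟨(hmem k).1 ht.2, ht.1⟩), rfl⟩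
    · rintro ⟨k, hk, rfl⟩
      rw [mem_coe, mem_filter] at hk
      exact ⟨hk.2, (hmem k).2 hk.1⟩
  rw [himage, Set.ncard_image_of_injective _ hinj, Set.ncard_coe_finset]

theorem tupleBall_ncard_of_subsingleton [Subsingleton κ] [Fintype ι] [DecidableEq ι]
    (x : κ) (p : ℕ) : (tupleBall b ι p).ncard = #(intCube ι p) := by
  classical
  simpa using ncard_inter_tupleBall_of_subsingleton b x (Set.univ : Set (ι → H)) p

variable {G : Type*} [Group G] (a : FreeGroupBasis ι G)

/-- A homomorphism to an infinite cyclic group is onto if and only if the exponents of the images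
of the generators are coprime. -/
theorem lift_surjective_iff_coordGcd [Subsingleton κ] [Fintype ι] (x : κ) (k : ι → ℤ) :
    Function.Surjective (a.lift fun i => b x ^ k i) ↔ coordGcd k = 1 := by
  rw [lift_surjective_iff (b := b), ← MonoidHom.range_eq_top, FreeGroup.range_lift_eq_closure]
  simp only [repr_zpow]
  constructor
  · intro h
    -- The image lies in the powers of `of x ^ coordGcd k`; if it contains `of x`, the gcd divides
    -- 1.
    have hle : Subgroup.closure (Set.range fun i => of x ^ k i) ≤
        Subgroup.zpowers (of x ^ coordGcd k) := by
      rw [Subgroup.closure_le]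
      rintro _ ⟨i, rfl⟩
      obtain ⟨m, hm⟩ := (dvd_coordGcd_iff (coordGcd k) k).1 dvd_rfl i
      exact ⟨m, by simp only [hm, zpow_mul, zpow_natCast]⟩
    rw [h] at hle
    obtain ⟨m, hm⟩ := hle (Subgroup.mem_top (of x))
    simp only [← zpow_natCast, ← zpow_mul] at hm
    have := zpow_of_injective x (a₂ := 1) (hm.trans (zpow_one _).symm)
    exact Nat.eq_one_of_dvd_one (Int.natCast_dvd_natCast.1 ⟨m, this.symm⟩)
  · intro h
    -- The exponents occurring in the image form a subgroup gℤ; g divides every `k i`, hence their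
    -- gcd, which is 1.
    let A : AddSubgroup ℤ :=
      { carrier := {n | of x ^ n ∈ Subgroup.closure (Set.range fun i => of x ^ k i)}
        zero_mem' := by simp
        add_mem' := fun hm hn => by
          simp only [Set.mem_ofPred_eq, zpow_add] at *
          exact mul_mem hm hn
        neg_mem' := fun hm => by
          simp only [Set.mem_ofPred_eq, zpow_neg] at *
          exact inv_mem hm }
    obtain ⟨g, hg⟩ := Int.subgroup_cyclic A
    rw [← AddSubgroup.zmultiples_eq_closure] at hg
    have hdvd : g.natAbs ∣ coordGcd k := by
      rw [dvd_coordGcd_iff]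
      intro i
      have hi : k i ∈ A := Subgroup.subset_closure ⟨i, rfl⟩
      rw [hg, Int.mem_zmultiples_iff] at hi
      exact Int.natAbs_dvd.2 hi
    rw [h, Nat.dvd_one] at hdvd
    have h1 : (1 : ℤ) ∈ A := by
      rw [hg, Int.mem_zmultiples_iff]
      exact Int.natAbs_dvd.1 (by simp [hdvd])
    rw [eq_top_iff]
    rintro w -
    obtain ⟨n, rfl⟩ := zpow_of_surjective x w
    have h1' : of x ^ (1 : ℤ) ∈ Subgroup.closure (Set.range fun i => of x ^ k i) := h1
    rw [zpow_one] at h1'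
    exact zpow_mem h1' n

/-- Two distinct basis elements do not commute, but their images in a cyclic group do. -/
theorem not_injective_of_one_lt_card {κ H ι G : Type*} [Group H] [Group G]
    (b : FreeGroupBasis κ H) (a : FreeGroupBasis ι G) [Subsingleton κ] [Fintype ι] (x : κ)
    (hι : 1 < Fintype.card ι) (φ : G →* H) : ¬ Function.Injective φ := by
  classical
  intro hφ
  obtain ⟨i, j, hij⟩ := Fintype.one_lt_card_iff.1 hι
  obtain ⟨m, hm⟩ := b.zpow_surjective x (φ (a i))
  obtain ⟨n, hn⟩ := b.zpow_surjective x (φ (a j))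
  have h : a i * a j = a j * a i := hφ (by
    rw [_root_.map_mul, _root_.map_mul, ← hm, ← hn]
    exact zpow_mul_comm _ _ _)
  have h' := congrArg (fun g => (a.repr g).toWord) h
  simp only [_root_.map_mul, FreeGroupBasis.repr_apply_coe, toWord_mul, toWord_of] at h'
  simp [hij, hij.symm] at h'

theorem lift_injective_of_unique [Unique ι] {x : κ} {n : ℤ} (hn : n ≠ 0) :
    Function.Injective (a.lift fun _ : ι => b x ^ n) := by
  rw [lift_injective_iff (b := b), injective_iff_map_eq_one]
  intro w hw
  obtain ⟨m, rfl⟩ := zpow_of_surjective default w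
  rw [map_zpow, lift_apply_of, repr_zpow, ← zpow_mul] at hw
  have : n * m = 0 := zpow_of_injective x (hw.trans (zpow_zero _).symm)
  simp [(mul_eq_zero.1 this).resolve_left hn]

/-- In an infinite cyclic group, bounded sets of tuples have density zero. -/
theorem hasTupleDensity_tupleBall [Subsingleton κ] [Fintype ι] [Nonempty ι] (x : κ) (q : ℕ) :
    HasTupleDensity b (tupleBall b ι q) 0 := by
  classical
  have hlim : Tendsto (fun p : ℕ => ((tupleBall b ι q).ncard : ℝ) / p) atTop (𝓝 0) :=
    tendsto_const_nhds.div_atTop tendsto_natCast_atTop_atTop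
  refine tendsto_of_tendsto_of_tendsto_of_le_of_le' tendsto_const_nhds hlim
    (Eventually.of_forall fun p => by positivity) ?_
  filter_upwards [eventually_gt_atTop 0] with p hp
  have hle : p ≤ (tupleBall b ι p).ncard := by
    rw [tupleBall_ncard_of_subsingleton b x, card_intCube]
    exact le_trans (by omega) (Nat.le_self_pow Fintype.card_ne_zero _)
  gcongr
  · exact tupleBall_finite b q
  · exact Set.inter_subset_left

variable [Fintype ι] [Fintype κ]

/-- A homomorphism is multiplication by an integer n: surjectivity forces |n| = 1 and
non-injectivity n = 0, so both exceptional sets lie in the ball of radius 1. -/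
theorem hasHomDensity_epis_monos_of_card_eq_one (hκ : Fintype.card κ = 1)
    (hι : Fintype.card ι = 1) :
    HasHomDensity a b (Epis G H) 0 ∧ HasHomDensity a b (Monos G H) 1 := by
  obtain ⟨x, -⟩ := Fintype.card_eq_one_iff.1 hκ
  have : Subsingleton κ := Fintype.card_le_one_iff_subsingleton.1 hκ.le
  obtain ⟨hu⟩ := Fintype.card_eq_one_iff_nonempty_unique.1 hι
  have h := hasTupleDensity_tupleBall (ι := ι) b x 1
  have hmem : ∀ n : ℤ, (fun _ : ι => b x ^ n) ∈ tupleBall b ι 1 ↔ n.natAbs ≤ 1 := by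
    intro n
    rw [← wordLength_zpow b x]
    exact ⟨fun h => h default, fun h _ => h⟩
  have hconst : ∀ t : ι → H, ∃ n : ℤ, t = fun _ => b x ^ n := by
    intro t
    obtain ⟨n, hn⟩ := b.zpow_surjective x (t default)
    exact ⟨n, funext fun i => by rw [Subsingleton.elim i default]; exact hn.symm⟩
  unfold HasHomDensity
  rw [image_eval_basis_eq, image_eval_basis_eq]
  constructor
  · refine h.mono_zero fun t ht => ?_
    obtain ⟨n, rfl⟩ := hconst t
    have := (lift_surjective_iff_coordGcd b a x fun _ => n).1 ht
    rw [hmem]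
    simp only [coordGcd, univ_unique, gcd_singleton, normalize_eq] at this
    exact this.le
  · have h' : HasTupleDensity b {t | a.lift t ∈ Monos G H}ᶜ 0 := by
      refine h.mono_zero fun t ht => ?_
      obtain ⟨n, rfl⟩ := hconst t
      rw [hmem]
      by_contra hn
      exact ht (lift_injective_of_unique b a (by rintro rfl; simp at hn))
    simpa using h'.compl

open scoped ArithmeticFunction.Moebius in
theorem hasHomDensity_epis_of_card_eq_one (hκ : Fintype.card κ = 1)
    (hι : 1 < Fintype.card ι) :
    HasHomDensity a b (Epis G H) (∑' d : ℕ, (μ d : ℝ) * (1 / d) ^ Fintype.card ι) := by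
  classical
  obtain ⟨x, -⟩ := Fintype.card_eq_one_iff.1 hκ
  have : Subsingleton κ := Fintype.card_le_one_iff_subsingleton.1 hκ.le
  unfold HasHomDensity
  rw [image_eval_basis_eq]
  refine (tendsto_card_filter_coordGcd_eq_one_div hι).congr fun p => ?_
  rw [ncard_inter_tupleBall_of_subsingleton b x, tupleBall_ncard_of_subsingleton b x]
  simp only [Epis, Set.mem_ofPred_eq, lift_surjective_iff_coordGcd]

theorem hasHomDensity_monos_of_card_eq_one (hκ : Fintype.card κ = 1)
    (hι : 1 < Fintype.card ι) : HasHomDensity a b (Monos G H) 0 := by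
  obtain ⟨x, -⟩ := Fintype.card_eq_one_iff.1 hκ
  have : Subsingleton κ := Fintype.card_le_one_iff_subsingleton.1 hκ.le
  have h : Monos G H = ∅ :=
    Set.eq_empty_of_forall_notMem fun φ => not_injective_of_one_lt_card b a x hι φ
  simp [HasHomDensity, HasTupleDensity, h]

end RankOne

theorem mainTheorem4 {ι κ G H : Type*} [Fintype ι] [Fintype κ] [Group G] [Group H]
    (a : FreeGroupBasis ι G) (b : FreeGroupBasis κ H) :
    (Fintype.card κ = 1 → 1 < Fintype.card ι →
      (∃ d : ℝ, (d : ℂ) = 1 / riemannZeta (Fintype.card ι : ℂ) ∧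
        HasHomDensity a b (Epis G H) d) ∧
      HasHomDensity a b (Monos G H) 0) ∧
    Tendsto (fun n : ℕ => riemannZeta (n : ℂ)) atTop (𝓝 1) ∧
    ((Fintype.card ι = 1 ∧ Fintype.card κ = 1) ∨ 1 < Fintype.card κ →
      HasHomDensity a b (Epis G H) 0 ∧ HasHomDensity a b (Monos G H) 1) := by
  refine ⟨fun hκ hι => ⟨⟨_, tsum_moebius_div_pow hι, hasHomDensity_epis_of_card_eq_one b a hκ hι⟩,
    hasHomDensity_monos_of_card_eq_one b a hκ hι⟩, tendsto_riemannZeta_natCast_atTop, ?_⟩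
  rintro (⟨hι, hκ⟩ | hκ)
  · exact hasHomDensity_epis_monos_of_card_eq_one b a hκ hι
  · exact hasHomDensity_epis_monos_of_one_lt_card a hκ
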